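/- Let $k\ge 2$ be an integer and let $\varepsilon>0$. There are constants $c_1\in\mathbb{R}$ and $c_2\in\mathbb{N}$, depending only on $k$ and $\varepsilon$, such that the following holds. Let $\mathcal F$ be a finite family of subsets of a set $U$, each of size at most $k$, let $n=|\mathcal F|\ge 2$, and let $\mathcal F_0\subseteq\mathcal F$ be a disjoint subfamily (any two distinct members are disjoint). Let $G_{\mathcal F_0}$ be the conflict graph: its vertex set is $\mathcal F$, and $S_1\in\mathcal F_0$ is adjacent to $S_2\in\mathcal F\setminus\mathcal F_0$ exactly when $S_1\cap S_2\neq\emptyset$ (there are no other edges). For a set of vertices $X$ let $N[X]$ be the set of the members of $X$ and all their neighbours in $G_{\mathcal F_0}$, and let $N(X)=N[X]\setminus X$. Call $X\subseteq\mathcal F\setminus\mathcal F_0$ an improving set if its members are pairwise disjoint and $|N(X)|<|X|$; its pathwidth is the pathwidth of the subgraph of $G_{\mathcal F_0}$ induced by $N[X]$. If there is no improving set of size at most $c_1\log n$ and pathwidth at most $c_2$, then $$|OPT|\le\left(\frac{k+1}{3}+\varepsilon\right)|\mathcal F_0|,$$ where $OPT\subseteq\mathcal F$ is a disjoint subfamily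 of maximum size. -/

import Mathlib

namespace SimpleGraph

/-- The closed neighbourhood `N_G[X]` of a set of vertices. -/
def closedNbhd {V : Type*} (G : SimpleGraph V) (X : Set V) : Set V :=
  ⋃ v ∈ X, insert v (G.neighborSet v)

/-- The open neighbourhood `N_G(X) = N_G[X] \ X` of a set of vertices. -/
def openNbhd {V : Type*} (G : SimpleGraph V) (X : Set V) : Set V :=
  G.closedNbhd X \ X

/-- A path decomposition of a graph: a finite sequence of bags. -/
structure PathDecomposition {V : Type*} (G : SimpleGraph V) where
  /-- the number of bags -/
  length : ℕ
  /-- the sequence of bags -/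
  bag : Fin length → Set V
  iUnion_bag : ⋃ i, bag i = Set.univ
  exists_bag_of_adj : ∀ u v : V, G.Adj u v → ∃ i, u ∈ bag i ∧ v ∈ bag i
  mem_bag_of_between : ∀ (v : V) (i l j : Fin length), i ≤ l → l ≤ j →
    v ∈ bag i → v ∈ bag j → v ∈ bag l

/-- The width of a path decomposition: the size of the largest bag minus one
(where `0 - 1 = 0`, which only concerns the graph without vertices). -/
noncomputable def PathDecomposition.width {V : Type*} {G : SimpleGraph V}
    (D : G.PathDecomposition) : ℕ∞ :=
  (⨆ i, (D.bag i).encard) - 1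

/-- The pathwidth of a graph: the minimum width of its path decompositions. -/
noncomputable def pathwidth {V : Type*} (G : SimpleGraph V) : ℕ∞ :=
  ⨅ D : G.PathDecomposition, D.width

end SimpleGraph

namespace SetPacking

/-- A disjoint family of sets: any two distinct members are disjoint. -/
def IsDisjointFamily {U : Type*} (F : Finset (Finset U)) : Prop :=
  ∀ S ∈ F, ∀ T ∈ F, S ≠ T → Disjoint S T

/-- `OPT` is a disjoint subfamily of `F` of maximum size. -/
structure IsMaximumDisjointSubfamily {U : Type*} (F OPT : Finset (Finset U)) : Prop where
  subset : OPT ⊆ F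
  disjoint : IsDisjointFamily OPT
  card_le : ∀ F' ⊆ F, IsDisjointFamily F' → F'.card ≤ OPT.card

/-- The conflict graph of `F₀ ⊆ F`: its vertices are the members of `F`, and a member of `F₀` is
adjacent to a member of `F \ F₀` when the two sets intersect. -/
def conflictGraph {U : Type*} (F F₀ : Finset (Finset U)) : SimpleGraph F where
  Adj S T := ((S.1 ∈ F₀ ∧ T.1 ∉ F₀) ∨ (T.1 ∈ F₀ ∧ S.1 ∉ F₀)) ∧ ¬ Disjoint S.1 T.1
  symm := ⟨fun _ _ h => ⟨h.1.symm, fun hd => h.2 hd.symm⟩⟩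
  loopless := ⟨fun _ h => by rcases h.1 with h | h <;> exact h.2 h.1⟩

/-- `X ⊆ F \ F₀` is an improving set: its members are pairwise disjoint, and it has fewer
neighbours in the conflict graph than members. -/
structure IsImprovingSet {U : Type*} (F F₀ : Finset (Finset U)) (X : Set F) : Prop where
  notMem : ∀ S ∈ X, S.1 ∉ F₀
  disjoint : ∀ S ∈ X, ∀ T ∈ X, S ≠ T → Disjoint S.1 T.1
  ncard_lt : ((conflictGraph F F₀).openNbhd X).ncard < X.ncard

/-- The pathwidth of an improving set `X`: that of the subgraph of the conflict graph induced by
the closed neighbourhood of `X`. -/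
noncomputable def improvingPathwidth {U : Type*} (F F₀ : Finset (Finset U)) (X : Set F) : ℕ∞ :=
  ((conflictGraph F F₀).induce ((conflictGraph F F₀).closedNbhd X)).pathwidth

end SetPacking

/-! Sets in both `OPT` and `F₀` contribute equally to both sizes, so compare `B = OPT \ F₀` with `A
= F₀ \ OPT` in the bipartite conflict graph, all of whose degrees are at most `k`. If every element
of `B` had degree at least 3, counting edges would give `3|B| ≤ k|A|`. Elements of degree 1 and 2
must therefore be controlled.

Degree 1 is handled by peeling: match each such element to its only neighbour and delete both. The
deleted part `R` of `A` is matched into `B`, so it costs no more than it pays. Since `R` cannot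
outgrow `A`, some round among boundedly many deletes at most `ε|A|` elements (`Stage.succ`,
`exists_stage_card_lowDegree_le`).

Degree 2 elements are edges of a multigraph on `A \ R`. With more than `(1 + ε)|A \ R|` of them,
breadth first search from a suitable root finds, at logarithmic depth, a set of edges spanning fewer
vertices than edges: two non-tree edges and the tree paths from their ends to the root
(`exists_layered_of_dense`). Adding the matched elements that pay for neighbours in `R` makes this
an improving set (`Stage.hasNarrowImprovement`). So there are at most `(1 + ε)|A \ R|` such
elements, and the degree count `three_mul_card_le` gives the factor `(k + 1)/3 + ε`.

For bounded pathwidth, the added elements must not link edges at distant depths. The search thus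
refuses an edge lying close in the conflict graph to one reached long ago. Growth is exponential, so
old edges are few and the refusals cost only half of the surplus `ε`. Sliding a window of constant
length over the depths then gives the path decomposition. -/

namespace SetPacking

/-! ### Breadth first search with refusals in dense multigraphs. -/

section Growth

variable {α β : Type*} [DecidableEq α] [DecidableEq β]

/-- The edges of the multigraph `(E, ends)` with all ends in `S`. -/
def innerEdges (E : Finset β) (ends : β → Finset α) (S : Finset α) : Finset β :=
  E.filter fun e => ends e ⊆ S

/-- The edges of the multigraph `(E, ends)` with an end in `S`. -/
def touchingEdges (E : Finset β) (ends : β → Finset α) (S : Finset α) : Finset β :=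
  E.filter fun e => ¬ Disjoint (ends e) S

/-- Breadth first search from `r` which refuses the edges in conflict (as given by `K`) with an
edge that was reached more than `d` rounds ago: the vertices and edges reached after `t` rounds. -/
def grow (E : Finset β) (ends : β → Finset α) (K : β → Finset β) (r : α) (d : ℕ) :
    ℕ → Finset α × Finset β
  | 0 => ({r}, ∅)
  | t + 1 =>
    let Q := (grow E ends K r d t).2 ∪ (touchingEdges E ends (grow E ends K r d t).1 \
      (grow E ends K r d (t - d)).2.biUnion K)
    ((grow E ends K r d t).1 ∪ Q.biUnion ends, Q)
  termination_by t => t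
  decreasing_by all_goals omega

section

variable (E : Finset β) (ends : β → Finset α) (K : β → Finset β) (r : α) (d : ℕ)

theorem grow_zero : grow E ends K r d 0 = ({r}, ∅) := by
  rw [grow]

theorem grow_succ_snd (t : ℕ) : (grow E ends K r d (t + 1)).2 =
    (grow E ends K r d t).2 ∪ (touchingEdges E ends (grow E ends K r d t).1 \
      (grow E ends K r d (t - d)).2.biUnion K) := by
  rw [grow]

theorem grow_succ_fst (t : ℕ) : (grow E ends K r d (t + 1)).1 =
    (grow E ends K r d t).1 ∪ (grow E ends K r d (t + 1)).2.biUnion ends := by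
  rw [grow_succ_snd, grow]

theorem grow_fst_mono : Monotone fun t => (grow E ends K r d t).1 :=
  monotone_nat_of_le_succ fun t => by
    simp only [grow_succ_fst]; exact Finset.subset_union_left

theorem grow_snd_mono : Monotone fun t => (grow E ends K r d t).2 :=
  monotone_nat_of_le_succ fun t => by
    simp only [grow_succ_snd]; exact Finset.subset_union_left

theorem grow_snd_subset_innerEdges (t : ℕ) :
    (grow E ends K r d t).2 ⊆ innerEdges E ends (grow E ends K r d t).1 := by
  induction t with
  | zero => simp [grow_zero]
  | succ t ih =>
    intro e he
    rw [innerEdges, Finset.mem_filter]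
    constructor
    · rw [grow_succ_snd, Finset.mem_union, Finset.mem_sdiff, touchingEdges,
        Finset.mem_filter] at he
      rcases he with he | he
      · exact (Finset.mem_filter.1 (ih he)).1
      · exact he.1.1
    · rw [grow_succ_fst]
      exact (Finset.subset_biUnion_of_mem ends he).trans Finset.subset_union_right

theorem root_mem_grow (t : ℕ) : r ∈ (grow E ends K r d t).1 :=
  grow_fst_mono E ends K r d (Nat.zero_le t) (by simp [grow_zero])

theorem grow_fst_subset {V : Finset α} (hr : r ∈ V) (hE : ∀ e ∈ E, ends e ⊆ V) (t : ℕ) :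
    (grow E ends K r d t).1 ⊆ V := by
  induction t with
  | zero => simpa [grow_zero] using hr
  | succ t ih =>
    rw [grow_succ_fst]
    refine Finset.union_subset ih (Finset.biUnion_subset.2 fun e he => hE e ?_)
    exact (Finset.mem_filter.1 (grow_snd_subset_innerEdges E ends K r d _ he)).1

theorem touchingEdges_grow_subset (t : ℕ) : touchingEdges E ends (grow E ends K r d t).1 ⊆
    innerEdges E ends (grow E ends K r d (t + 1)).1 ∪
      (grow E ends K r d (t - d)).2.biUnion K := by
  intro e he
  rw [Finset.mem_union]
  by_cases h : e ∈ (grow E ends K r d (t - d)).2.biUnion K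
  · exact Or.inr h
  · refine Or.inl (grow_snd_subset_innerEdges E ends K r d _ ?_)
    rw [grow_succ_snd, Finset.mem_union, Finset.mem_sdiff]
    exact Or.inr ⟨he, h⟩

variable {E ends K r d}

/-- As long as the reached set spans no more edges than vertices, the expansion `hV` turns touching
edges into new vertices. The refused edges number at most `D` times the edges reached `d` rounds
earlier, and `hd` makes this at most `ε / 2` times the current size because of the growth in
between. -/
theorem pow_le_card_grow {ε : ℝ} (hε : 0 < ε) {D T : ℕ} {V : Finset α}
    (hV : ∀ S ⊆ V, (1 + ε) * S.card ≤ (touchingEdges E ends S).card)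
    (hr : r ∈ V) (hE : ∀ e ∈ E, ends e ⊆ V) (hK : ∀ e ∈ E, (K e).card ≤ D)
    (hd : (D : ℝ) ≤ ε / 2 * (1 + ε / 2) ^ d)
    (hin : ∀ t ≤ T, (innerEdges E ends (grow E ends K r d t).1).card ≤
      (grow E ends K r d t).1.card) :
    (1 + ε / 2) ^ T ≤ ((grow E ends K r d T).1.card : ℝ) := by
  set S : ℕ → Finset α := fun t => (grow E ends K r d t).1 with hS
  set Q : ℕ → Finset β := fun t => (grow E ends K r d t).2 with hQ
  have hQS : ∀ t ≤ T, (Q t).card ≤ (S t).card := fun t ht =>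
    (Finset.card_le_card (grow_snd_subset_innerEdges E ends K r d t)).trans (hin t ht)
  have hstep : ∀ t, t + 1 ≤ T →
      (1 + ε) * (S t).card ≤ ((S (t + 1)).card : ℝ) + D * (Q (t - d)).card := by
    intro t ht
    have h1 := hV _ (grow_fst_subset E ends K r d hr hE t)
    have h2 : (touchingEdges E ends (S t)).card ≤ (S (t + 1)).card + D * (Q (t - d)).card := by
      refine (Finset.card_le_card (touchingEdges_grow_subset E ends K r d t)).trans
        ((Finset.card_union_le _ _).trans (add_le_add (hin _ ht) ?_))
      rw [mul_comm]
      refine Finset.card_biUnion_le_card_mul _ _ _ fun e he => hK e ?_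
      exact (Finset.mem_filter.1 (grow_snd_subset_innerEdges E ends K r d _ he)).1
    have h3 : ((touchingEdges E ends (S t)).card : ℝ) ≤
        (S (t + 1)).card + D * (Q (t - d)).card := by exact_mod_cast h2
    exact h1.trans h3
  have hgrow : ∀ t, t + 1 ≤ T → (1 + ε / 2) * (S t).card ≤ ((S (t + 1)).card : ℝ) := by
    intro t
    induction t using Nat.strong_induction_on with
    | _ t ih =>
      intro ht
      have h1 := hstep t ht
      rcases lt_or_ge t d with htd | htd
      -- Here `t - d` truncates to round 0, when no edge has been reached, so nothing is refused.
      · have : Q (t - d) = ∅ := by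
          simp [hQ, Nat.sub_eq_zero_of_le htd.le, grow_zero]
        rw [this] at h1
        simp only [Finset.card_empty, Nat.cast_zero, mul_zero, add_zero] at h1
        have : (0 : ℝ) ≤ (S t).card := Nat.cast_nonneg _
        nlinarith
      · have hpow : ∀ j ≤ d, (1 + ε / 2) ^ j * (S (t - d)).card ≤ ((S (t - d + j)).card : ℝ) := by
          intro j
          induction j with
          | zero => simp
          | succ j ihj =>
            intro hj
            have h2 := ih (t - d + j) (by omega) (by omega)
            have h3 := mul_le_mul_of_nonneg_left (ihj (by omega))
              (show (0 : ℝ) ≤ 1 + ε / 2 by positivity)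
            rw [pow_succ', mul_assoc]
            exact h3.trans h2
        have h2 := hpow d le_rfl
        rw [Nat.sub_add_cancel htd] at h2
        have h3 : ((Q (t - d)).card : ℝ) ≤ (S (t - d)).card := by
          exact_mod_cast hQS (t - d) (by omega)
        have h4 : (D : ℝ) * (Q (t - d)).card ≤ ε / 2 * (S t).card :=
          calc (D : ℝ) * (Q (t - d)).card ≤ D * (S (t - d)).card := by gcongr
            _ ≤ ε / 2 * (1 + ε / 2) ^ d * (S (t - d)).card := by gcongr
            _ = ε / 2 * ((1 + ε / 2) ^ d * (S (t - d)).card) := by ring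
            _ ≤ ε / 2 * (S t).card := by gcongr
        linarith
  have hfin : ∀ t ≤ T, (1 + ε / 2) ^ t ≤ ((S t).card : ℝ) := by
    intro t
    induction t with
    | zero => simp [hS, grow_zero]
    | succ t ih =>
      intro ht
      rw [pow_succ']
      exact (mul_le_mul_of_nonneg_left (ih (by omega)) (by positivity)).trans (hgrow t ht)
  exact hfin T le_rfl

/-- The round in which an edge is reached. -/
noncomputable def edgeDepth (E : Finset β) (ends : β → Finset α) (K : β → Finset β) (r : α) (d : ℕ)
    (e : β) : ℕ :=
  sInf {t | e ∈ (grow E ends K r d t).2}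

/-- The round in which a vertex is reached. -/
noncomputable def vertexDepth (E : Finset β) (ends : β → Finset α) (K : β → Finset β) (r : α)
    (d : ℕ) (v : α) : ℕ :=
  sInf {t | v ∈ (grow E ends K r d t).1}

theorem edgeDepth_le {e : β} {t : ℕ} (he : e ∈ (grow E ends K r d t).2) :
    edgeDepth E ends K r d e ≤ t := Nat.sInf_le he

theorem mem_grow_edgeDepth {e : β} {t : ℕ} (he : e ∈ (grow E ends K r d t).2) :
    e ∈ (grow E ends K r d (edgeDepth E ends K r d e)).2 :=
  Nat.sInf_mem (s := {t | e ∈ (grow E ends K r d t).2}) ⟨t, he⟩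

theorem vertexDepth_le {v : α} {t : ℕ} (hv : v ∈ (grow E ends K r d t).1) :
    vertexDepth E ends K r d v ≤ t := Nat.sInf_le hv

theorem mem_grow_vertexDepth {v : α} {t : ℕ} (hv : v ∈ (grow E ends K r d t).1) :
    v ∈ (grow E ends K r d (vertexDepth E ends K r d v)).1 :=
  Nat.sInf_mem (s := {t | v ∈ (grow E ends K r d t).1}) ⟨t, hv⟩

/-- Were `f` to enter later than this, `e` would already be among the old edges consulted in that
round, and `f` would be refused. -/
theorem edgeDepth_le_add_of_mem {e f : β} {s t : ℕ} (he : e ∈ (grow E ends K r d s).2)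
    (hf : f ∈ (grow E ends K r d t).2) (hK : f ∈ K e) :
    edgeDepth E ends K r d f ≤ edgeDepth E ends K r d e + d := by
  by_contra! hlt
  have hf' := mem_grow_edgeDepth hf
  obtain ⟨j, hj⟩ : ∃ j, edgeDepth E ends K r d f = j + 1 := ⟨_, (Nat.succ_pred (by omega)).symm⟩
  rw [hj, grow_succ_snd, Finset.mem_union, Finset.mem_sdiff] at hf'
  rcases hf' with h | h
  · have := edgeDepth_le h
    omega
  · refine h.2 (Finset.mem_biUnion.2 ⟨e, ?_, hK⟩)
    exact grow_snd_mono E ends K r d (show edgeDepth E ends K r d e ≤ j - d by omega)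
      (mem_grow_edgeDepth he)

/-- The edge that brings in `v` is new in that round, so it touches a vertex reached earlier. These
parents form the search tree. -/
theorem exists_parent {v : α} {t : ℕ} (hv : v ∈ (grow E ends K r d t).1) (hvr : v ≠ r) :
    ∃ (e : β) (u : α), e ∈ (grow E ends K r d t).2 ∧ v ∈ ends e ∧ u ∈ ends e ∧
      edgeDepth E ends K r d e = vertexDepth E ends K r d v ∧
      u ∈ (grow E ends K r d t).1 ∧ vertexDepth E ends K r d u < vertexDepth E ends K r d v := by
  have hv' := mem_grow_vertexDepth hv
  have hle := vertexDepth_le hv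
  obtain ⟨j, hj⟩ : ∃ j, vertexDepth E ends K r d v = j + 1 := by
    refine ⟨_, (Nat.succ_pred fun h0 => hvr ?_).symm⟩
    simpa [h0, grow_zero] using hv'
  have hnot : v ∉ (grow E ends K r d j).1 := fun h => by
    have := vertexDepth_le h
    omega
  rw [hj, grow_succ_fst, Finset.mem_union, or_iff_right hnot, Finset.mem_biUnion] at hv'
  obtain ⟨e, he, hve⟩ := hv'
  have henot : e ∉ (grow E ends K r d j).2 := fun h =>
    hnot ((Finset.mem_filter.1 (grow_snd_subset_innerEdges E ends K r d j h)).2 hve)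
  have he' := he
  rw [grow_succ_snd, Finset.mem_union, or_iff_right henot, Finset.mem_sdiff, touchingEdges,
    Finset.mem_filter, Finset.not_disjoint_iff] at he'
  obtain ⟨⟨-, u, hue, huS⟩, -⟩ := he'
  have hu := vertexDepth_le huS
  refine ⟨e, u, grow_snd_mono E ends K r d (show j + 1 ≤ t by omega) he, hve, hue, ?_,
    grow_fst_mono E ends K r d (show j ≤ t by omega) huS, by omega⟩
  have h1 := edgeDepth_le he
  have h2 : ¬ edgeDepth E ends K r d e ≤ j := fun h =>
    henot (grow_snd_mono E ends K r d h (mem_grow_edgeDepth he))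
  omega

end

/-- If `p` strictly decreases the rank `δ` on `S \ {r}`, every element of `S` lies in a `p`-closed
set with at most one element of each rank. -/
theorem exists_closed_of_lt {S : Finset α} {r : α} (hr : r ∈ S) (p : α → α) (δ : α → ℕ)
    (hp : ∀ v ∈ S, v ≠ r → p v ∈ S ∧ δ (p v) < δ v) {v : α} (hv : v ∈ S) :
    ∃ W ⊆ S, v ∈ W ∧ r ∈ W ∧ (∀ w ∈ W, w ≠ r → p w ∈ W) ∧
      (∀ w ∈ W, w ≠ r → δ w ≤ δ v) ∧ Set.InjOn δ {w | w ∈ W ∧ w ≠ r} := by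
  induction hn : δ v using Nat.strong_induction_on generalizing v with
  | _ n ih =>
    by_cases hvr : v = r
    · subst hvr
      refine ⟨{v}, by simpa using hv, by simp, by simp, by simp, by simp, ?_⟩
      intro w hw
      simp at hw
    · obtain ⟨hpS, hlt⟩ := hp v hv hvr
      obtain ⟨W, hWS, hpW, hrW, hcl, hle, hinj⟩ := ih _ (hn ▸ hlt) hpS rfl
      refine ⟨insert v W, Finset.insert_subset hv hWS, Finset.mem_insert_self _ _,
        Finset.mem_insert_of_mem hrW, ?_, ?_, ?_⟩
      · intro w hw hwr
        rcases Finset.mem_insert.1 hw with rfl | hw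
        · exact Finset.mem_insert_of_mem hpW
        · exact Finset.mem_insert_of_mem (hcl w hw hwr)
      · intro w hw hwr
        rcases Finset.mem_insert.1 hw with rfl | hw
        · exact hn.le
        · have := hle w hw hwr
          omega
      · rintro a ⟨ha, har⟩ b ⟨hb, hbr⟩ hab
        rcases Finset.mem_insert.1 ha with ha' | ha' <;>
          rcases Finset.mem_insert.1 hb with hb' | hb'
        · rw [ha', hb']
        · have := hle b hb' hbr
          rw [ha'] at hab
          omega
        · have := hle a ha' har
          rw [hb'] at hab
          omega
        · exact hinj ⟨ha', har⟩ ⟨hb', hbr⟩ hab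

/-- A multigraph with more edges than vertices on the set reached by `grow` contains a set of edges
with more edges than vertices, two of which are arbitrary, the others having at most four edges
for each depth. -/
theorem exists_layered_of_card_lt {E : Finset β} {ends : β → Finset α} {K : β → Finset β} {r : α}
    {d t : ℕ} (hE : ∀ e ∈ E, (ends e).card ≤ 2)
    (hin : (grow E ends K r d t).1.card < (innerEdges E ends (grow E ends K r d t).1).card) :
    ∃ (Z W : Finset β) (δ : β → ℕ), Z ⊆ E ∧ W ⊆ E ∧ W.card ≤ 2 ∧
      ((Z ∪ W).biUnion ends).card < (Z ∪ W).card ∧ (∀ z ∈ Z, δ z ≤ t) ∧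
      (∀ s, (Z.filter fun z => δ z = s).card ≤ 4) ∧
      ∀ z ∈ Z, ∀ z' ∈ Z, z' ∈ K z → δ z' ≤ δ z + d := by
  classical
  set S := (grow E ends K r d t).1 with hS
  set Q := (grow E ends K r d t).2 with hQ
  set δV := vertexDepth E ends K r d
  set δE := edgeDepth E ends K r d
  have hr : r ∈ S := root_mem_grow E ends K r d t
  have hQI : Q ⊆ innerEdges E ends S := grow_snd_subset_innerEdges E ends K r d t
  have hIE : innerEdges E ends S ⊆ E := Finset.filter_subset _ _
  obtain ⟨e₀, -⟩ := Finset.card_pos.1 (Nat.zero_lt_of_lt hin)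
  have hpar : ∀ v, ∃ (e : β) (u : α), v ∈ S → v ≠ r → e ∈ Q ∧ v ∈ ends e ∧ u ∈ ends e ∧
      δE e = δV v ∧ u ∈ S ∧ δV u < δV v := by
    intro v
    by_cases h : v ∈ S ∧ v ≠ r
    · obtain ⟨e, u, h'⟩ := exists_parent h.1 h.2
      exact ⟨e, u, fun _ _ => h'⟩
    · exact ⟨e₀, r, fun h1 h2 => absurd ⟨h1, h2⟩ h⟩
  choose par p hpp using hpar
  have hends : ∀ v ∈ S, v ≠ r → ends (par v) = {v, p v} := by
    intro v hv hvr
    obtain ⟨h1, h2, h3, h4, h5, h6⟩ := hpp v hv hvr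
    have hne : v ≠ p v := fun h => by rw [← h] at h6; omega
    refine (Finset.eq_of_subset_of_card_le ?_ ?_).symm
    · intro x hx
      rcases Finset.mem_insert.1 hx with rfl | hx
      · exact h2
      · rw [Finset.mem_singleton.1 hx]; exact h3
    · rw [Finset.card_pair hne]
      exact hE _ (hIE (hQI h1))
  -- A tree edge has the depth of its deeper end, so it cannot be the parent edge of its other end.
  have hinj : Set.InjOn par {v | v ∈ S ∧ v ≠ r} := by
    rintro v ⟨hv, hvr⟩ w ⟨hw, hwr⟩ hvw
    have h1 := hpp v hv hvr
    have h2 := hpp w hw hwr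
    have hmem : w ∈ ({v, p v} : Finset α) := by
      rw [← hends v hv hvr, hvw]; exact h2.2.1
    rcases Finset.mem_insert.1 hmem with rfl | hmem
    · rfl
    · have h3 := h1.2.2.2.1
      have h4 := h2.2.2.2.1
      have h5 := h1.2.2.2.2.2
      rw [hvw] at h3
      rw [← Finset.mem_singleton.1 hmem] at h5
      omega
  have htree : ((S.erase r).image par).card ≤ S.card - 1 := by
    refine Finset.card_image_le.trans ?_
    rw [Finset.card_erase_of_mem hr]
  have hSpos : 0 < S.card := Finset.card_pos.2 ⟨r, hr⟩
  -- At least `|S| + 1` edges, at most `|S| - 1` of them in the tree, leave two non-tree edges.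
  obtain ⟨W, hWsub, hWcard⟩ :
      ∃ W ⊆ innerEdges E ends S \ (S.erase r).image par, W.card = 2 := by
    refine Finset.exists_subset_card_eq ?_
    have := Finset.le_card_sdiff ((S.erase r).image par) (innerEdges E ends S)
    omega
  have hWI : W ⊆ innerEdges E ends S := hWsub.trans Finset.sdiff_subset
  have hWS : W.biUnion ends ⊆ S :=
    Finset.biUnion_subset.2 fun e he => (Finset.mem_filter.1 (hWI he)).2
  have hWends : (W.biUnion ends).card ≤ 4 :=
    (Finset.card_biUnion_le_card_mul W ends 2 fun e he => hE e (hIE (hWI he))).trans (by omega)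
  have hcl : ∀ v, ∃ C, v ∈ S → C ⊆ S ∧ v ∈ C ∧ r ∈ C ∧ (∀ w ∈ C, w ≠ r → p w ∈ C) ∧
      Set.InjOn δV {w | w ∈ C ∧ w ≠ r} := by
    intro v
    by_cases hv : v ∈ S
    · obtain ⟨C, h1, h2, h3, h4, -, h6⟩ := exists_closed_of_lt hr p δV
        (fun v hv hvr => ⟨(hpp v hv hvr).2.2.2.2.1, (hpp v hv hvr).2.2.2.2.2⟩) hv
      exact ⟨C, fun _ => ⟨h1, h2, h3, h4, h6⟩⟩
    · exact ⟨∅, fun h => absurd h hv⟩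
  choose C hC using hcl
  -- `Y` is a subtree: the union of the tree paths from the at most four ends of `W` to the root.
  -- Its `|Y| - 1` tree edges together with `W` exceed `|Y|` by one.
  set Y := insert r ((W.biUnion ends).biUnion C) with hY
  have hYS : Y ⊆ S := Finset.insert_subset hr
    (Finset.biUnion_subset.2 fun v hv => (hC v (hWS hv)).1)
  set Z := (Y.erase r).image par with hZ
  have hZQ : Z ⊆ Q := by
    intro z hz
    obtain ⟨v, hv, rfl⟩ := Finset.mem_image.1 hz
    rw [Finset.mem_erase] at hv
    exact (hpp v (hYS hv.2) hv.1).1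
  have hZdepth : ∀ v ∈ Y.erase r, δE (par v) = δV v := by
    intro v hv
    rw [Finset.mem_erase] at hv
    exact (hpp v (hYS hv.2) hv.1).2.2.2.1
  have hZcard : Z.card = Y.card - 1 := by
    rw [hZ, Finset.card_image_of_injOn, Finset.card_erase_of_mem (Finset.mem_insert_self _ _)]
    intro v hv w hw hvw
    simp only [Finset.coe_erase, Set.mem_sdiff, Finset.mem_coe, Set.mem_singleton_iff] at hv hw
    exact hinj ⟨hYS hv.1, hv.2⟩ ⟨hYS hw.1, hw.2⟩ hvw
  have hdisj : Disjoint Z W := by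
    rw [Finset.disjoint_left]
    intro z hz hzW
    refine (Finset.mem_sdiff.1 (hWsub hzW)).2 ?_
    exact Finset.image_subset_image (Finset.erase_subset_erase r hYS) hz
  refine ⟨Z, W, δE, hZQ.trans (hQI.trans hIE), hWI.trans hIE, hWcard.le, ?_, ?_, ?_, ?_⟩
  · have hsub : (Z ∪ W).biUnion ends ⊆ Y := by
      refine Finset.biUnion_subset.2 fun e he => ?_
      rcases Finset.mem_union.1 he with he | he
      · obtain ⟨v, hv, rfl⟩ := Finset.mem_image.1 he
        rw [Finset.mem_erase] at hv
        rw [hends v (hYS hv.2) hv.1]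
        refine Finset.insert_subset hv.2 (Finset.singleton_subset_iff.2 ?_)
        obtain ⟨w, hw, hvw⟩ := Finset.mem_biUnion.1
          ((Finset.mem_insert.1 (hY ▸ hv.2)).resolve_left hv.1)
        exact Finset.mem_insert_of_mem
          (Finset.mem_biUnion.2 ⟨w, hw, (hC w (hWS hw)).2.2.2.1 v hvw hv.1⟩)
      · intro v hv
        have hvW : v ∈ W.biUnion ends := Finset.mem_biUnion.2 ⟨e, he, hv⟩
        exact Finset.mem_insert_of_mem
          (Finset.mem_biUnion.2 ⟨v, hvW, (hC v (hWS hvW)).2.1⟩)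
    have hYpos : 0 < Y.card := Finset.card_pos.2 ⟨r, Finset.mem_insert_self _ _⟩
    have := Finset.card_le_card hsub
    rw [Finset.card_union_of_disjoint hdisj]
    omega
  · exact fun z hz => edgeDepth_le (hZQ hz)
  · intro s
    -- Each of the at most four paths has at most one non-root vertex at depth `s`.
    have hsub : Z.filter (fun z => δE z = s) ⊆ (W.biUnion ends).biUnion
        fun v => (((C v).erase r).filter fun w => δV w = s).image par := by
      intro z hz
      obtain ⟨hz, hzs⟩ := Finset.mem_filter.1 hz
      obtain ⟨v, hv, rfl⟩ := Finset.mem_image.1 hz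
      rw [hZdepth v hv] at hzs
      obtain ⟨hvr, hvY⟩ := Finset.mem_erase.1 hv
      obtain ⟨w, hw, hvw⟩ := Finset.mem_biUnion.1
        ((Finset.mem_insert.1 (hY ▸ hvY)).resolve_left hvr)
      exact Finset.mem_biUnion.2 ⟨w, hw, Finset.mem_image_of_mem _
        (Finset.mem_filter.2 ⟨Finset.mem_erase.2 ⟨hvr, hvw⟩, hzs⟩)⟩
    refine (Finset.card_le_card hsub).trans ?_
    refine (Finset.card_biUnion_le_card_mul _ _ 1 fun v hv => ?_).trans (by omega)
    refine Finset.card_image_le.trans (Finset.card_le_one.2 fun a ha b hb => ?_)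
    rw [Finset.mem_filter, Finset.mem_erase] at ha hb
    exact (hC v (hWS hv)).2.2.2.2 ⟨ha.1.2, ha.1.1⟩ ⟨hb.1.2, hb.1.1⟩ (ha.2.trans hb.2.symm)
  · exact fun z hz z' hz' h => edgeDepth_le_add_of_mem (hZQ hz) (hZQ hz') h

/-- A multigraph of density at least `1 + ε` with a conflict relation of bounded degree has a set of
edges spanning fewer vertices than it has edges, of logarithmic depth, with only four edges
for each depth (apart from two exceptional edges), such that conflicting edges
have almost the same depth. -/
theorem exists_layered_of_dense {E : Finset β} {V : Finset α} {ends : β → Finset α}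
    {K : β → Finset β} {D d T : ℕ} {ε : ℝ} (hε : 0 < ε) (hEV : ∀ e ∈ E, ends e ⊆ V)
    (hE2 : ∀ e ∈ E, (ends e).card ≤ 2) (hE0 : ∀ e ∈ E, (ends e).Nonempty)
    (hK : ∀ e ∈ E, (K e).card ≤ D) (hd : (D : ℝ) ≤ ε / 2 * (1 + ε / 2) ^ d)
    (hT : (V.card : ℝ) < (1 + ε / 2) ^ T) (hV : V.Nonempty) (hE : (1 + ε) * V.card ≤ E.card) :
    ∃ (Z W : Finset β) (δ : β → ℕ), Z ⊆ E ∧ W ⊆ E ∧ W.card ≤ 2 ∧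
      ((Z ∪ W).biUnion ends).card < (Z ∪ W).card ∧ (∀ z ∈ Z, δ z ≤ T) ∧
      (∀ s, (Z.filter fun z => δ z = s).card ≤ 4) ∧
      ∀ z ∈ Z, ∀ z' ∈ Z, z' ∈ K z → δ z' ≤ δ z + d := by
  classical
  -- A smallest nonempty vertex set of density at least `1 + ε` expands: deleting `S` must not leave
  -- a denser set, so `S` touches at least `(1 + ε)|S|` edges.
  obtain ⟨V', hV', hmin⟩ := Finset.exists_min_image (V.powerset.filter fun S =>
    S.Nonempty ∧ (1 + ε) * S.card ≤ ((innerEdges E ends S).card : ℝ)) Finset.card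
    ⟨V, by
      rw [Finset.mem_filter, innerEdges, Finset.filter_true_of_mem hEV]
      exact ⟨Finset.mem_powerset_self _, hV, hE⟩⟩
  rw [Finset.mem_filter, Finset.mem_powerset] at hV'
  obtain ⟨hV'V, hne, hdense⟩ := hV'
  obtain ⟨r, hr⟩ := hne
  set E' := innerEdges E ends V' with hE'
  have hE'E : E' ⊆ E := Finset.filter_subset _ _
  have hE'V : ∀ e ∈ E', ends e ⊆ V' := fun e he => (Finset.mem_filter.1 he).2
  have htouch : ∀ S ⊆ V', (1 + ε) * S.card ≤ ((touchingEdges E' ends S).card : ℝ) := by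
    intro S hS
    rcases S.eq_empty_or_nonempty with rfl | hSne
    · simp
    have h1 : E'.card ≤ (touchingEdges E' ends S).card +
        (innerEdges E ends (V' \ S)).card := by
      refine (Finset.card_le_card fun e he => ?_).trans (Finset.card_union_le _ _)
      rw [Finset.mem_union, touchingEdges, innerEdges, Finset.mem_filter, Finset.mem_filter,
        Finset.subset_sdiff]
      by_cases h : Disjoint (ends e) S
      · exact Or.inr ⟨hE'E he, hE'V e he, h⟩
      · exact Or.inl ⟨he, h⟩
    have h2 : ((innerEdges E ends (V' \ S)).card : ℝ) ≤ (1 + ε) * (V' \ S).card := by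
      rcases (V' \ S).eq_empty_or_nonempty with h0 | h0
      · rw [h0, innerEdges, Finset.filter_false_of_mem]
        · simp
        · intro e he hsub
          exact (hE0 e he).ne_empty (Finset.subset_empty.1 hsub)
      · by_contra! hlt
        have := hmin (V' \ S) (Finset.mem_filter.2 ⟨Finset.mem_powerset.2
          (Finset.sdiff_subset.trans hV'V), h0, hlt.le⟩)
        have h3 := Finset.card_sdiff_add_card_eq_card hS
        have h4 := Finset.card_pos.2 hSne
        omega
    have h3 : ((V' \ S).card : ℝ) + S.card = V'.card := by
      exact_mod_cast Finset.card_sdiff_add_card_eq_card hS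
    have h4 : (E'.card : ℝ) ≤ (touchingEdges E' ends S).card +
        (innerEdges E ends (V' \ S)).card := by exact_mod_cast h1
    rw [← h3] at hdense
    linarith
  -- If no round sees more inner edges than vertices, the exponential growth up to round `T` exceeds
  -- `|V|`.
  by_cases hin : ∀ t ≤ T, (innerEdges E' ends (grow E' ends K r d t).1).card ≤
      (grow E' ends K r d t).1.card
  · exfalso
    have h1 := pow_le_card_grow hε htouch hr hE'V (fun e he => hK e (hE'E he)) hd hin
    have h2 : ((grow E' ends K r d T).1.card : ℝ) ≤ V.card := by
      exact_mod_cast Finset.card_le_card ((grow_fst_subset E' ends K r d hr hE'V T).trans hV'V)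
    linarith
  · push Not at hin
    obtain ⟨t, htT, ht⟩ := hin
    obtain ⟨Z, W, δ, h1, h2, h3, h4, h5, h6, h7⟩ :=
      exists_layered_of_card_lt (fun e he => hE2 e (hE'E he)) ht
    exact ⟨Z, W, δ, h1.trans hE'E, h2.trans hE'E, h3, h4, fun z hz => (h5 z hz).trans htT, h6, h7⟩

end Growth

/-- Counting by degrees: `3 |B'| ≤ k |A'| + 2 |B₁| + |B₂|` for a bipartite graph on `A'` and `B'`
where `B₁` and `B₂` are the elements of `B'` of degree one and two. -/
theorem three_mul_card_le {α β : Type*} [DecidableEq α] {A' : Finset α} {B' : Finset β} {N' : β → Finset α} {k : ℕ}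
    (hNA : ∀ b ∈ B', N' b ⊆ A') (hN0 : ∀ b ∈ B', (N' b).Nonempty)
    (hdeg : ∀ a ∈ A', (B'.filter fun b => a ∈ N' b).card ≤ k) :
    3 * B'.card ≤ k * A'.card + 2 * (B'.filter fun b => (N' b).card ≤ 1).card +
      (B'.filter fun b => (N' b).card = 2).card := by
  have h1 : ∑ b ∈ B', (N' b).card ≤ k * A'.card := by
    have h2 := Finset.sum_card_bipartiteAbove_eq_sum_card_bipartiteBelow
      (s := B') (t := A') fun b a => a ∈ N' b
    have h3 : ∑ b ∈ B', (N' b).card =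
        ∑ b ∈ B', (Finset.bipartiteAbove (fun b a => a ∈ N' b) A' b).card := by
      refine Finset.sum_congr rfl fun b hb => congrArg _ ?_
      ext a
      simpa [Finset.bipartiteAbove] using fun ha => hNA b hb ha
    rw [h3, h2, mul_comm, ← smul_eq_mul]
    exact Finset.sum_le_card_nsmul _ _ _ hdeg
  have h4 : 3 * B'.card ≤ ∑ b ∈ B', ((N' b).card + 2 * (if (N' b).card ≤ 1 then 1 else 0) +
      (if (N' b).card = 2 then 1 else 0)) := by
    rw [mul_comm, ← smul_eq_mul]
    refine Finset.card_nsmul_le_sum _ _ _ fun b hb => ?_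
    have := Finset.card_pos.2 (hN0 b hb)
    split_ifs <;> omega
  rw [Finset.sum_add_distrib, Finset.sum_add_distrib, ← Finset.mul_sum, ← Finset.card_filter,
    ← Finset.card_filter] at h4
  omega

/-! ### Peeling off elements of degree one, and narrow improvements. -/

section Ball

variable {α β : Type*} [DecidableEq α] [DecidableEq β]

/-- The elements of `B` at distance at most `j` from `b`, where distinct elements are adjacent
when their neighbourhoods meet. -/
def ball (B : Finset β) (N : β → Finset α) : ℕ → β → Finset β
  | 0, b => {b}
  | j + 1, b => (B.filter fun c => b = c ∨ ¬ Disjoint (N b) (N c)).biUnion (ball B N j)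

variable {B : Finset β} {N : β → Finset α}

theorem ball_subset (j : ℕ) {b : β} (hb : b ∈ B) : ball B N j b ⊆ B := by
  induction j generalizing b with
  | zero => simpa [ball] using hb
  | succ j ih => exact Finset.biUnion_subset.2 fun c hc => ih (Finset.mem_filter.1 hc).1

theorem mem_ball_succ {j : ℕ} {b c f : β} (hc : c ∈ B) (hbc : b = c ∨ ¬ Disjoint (N b) (N c))
    (hf : f ∈ ball B N j c) : f ∈ ball B N (j + 1) b :=
  Finset.mem_biUnion.2 ⟨c, Finset.mem_filter.2 ⟨hc, hbc⟩, hf⟩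

theorem mem_ball_add {i j : ℕ} {b c f : β} (hc : c ∈ ball B N i b) (hf : f ∈ ball B N j c) :
    f ∈ ball B N (i + j) b := by
  induction i generalizing b with
  | zero =>
    rw [ball, Finset.mem_singleton] at hc
    rwa [← hc, Nat.zero_add]
  | succ i ih =>
    obtain ⟨g, hg, hcg⟩ := Finset.mem_biUnion.1 hc
    rw [Finset.mem_filter] at hg
    rw [Nat.add_right_comm]
    exact mem_ball_succ hg.1 hg.2 (ih hcg)

theorem mem_ball_one {b c : β} (hc : c ∈ B) (hbc : b = c ∨ ¬ Disjoint (N b) (N c)) :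
    c ∈ ball B N 1 b :=
  mem_ball_succ hc hbc (by simp [ball])

theorem mem_ball_symm {j : ℕ} {b f : β} (hb : b ∈ B) (hf : f ∈ ball B N j b) :
    b ∈ ball B N j f := by
  induction j generalizing b with
  | zero =>
    rw [ball, Finset.mem_singleton] at hf
    simp [ball, hf]
  | succ j ih =>
    obtain ⟨c, hc, hfc⟩ := Finset.mem_biUnion.1 hf
    rw [Finset.mem_filter] at hc
    exact mem_ball_add (ih hc.1 hfc)
      (mem_ball_one hb (hc.2.imp Eq.symm fun h h' => h h'.symm))

theorem ball_subset_ball_succ (j : ℕ) {b : β} (hb : b ∈ B) :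
    ball B N j b ⊆ ball B N (j + 1) b := fun _ hf => mem_ball_succ hb (Or.inl rfl) hf

theorem card_ball_le {k : ℕ} (hN : ∀ b ∈ B, (N b).card ≤ k)
    (hdeg : ∀ a, (B.filter fun b => a ∈ N b).card ≤ k) (j : ℕ) {b : β} (hb : b ∈ B) :
    (ball B N j b).card ≤ (k * k + 1) ^ j := by
  induction j generalizing b with
  | zero => simp [ball]
  | succ j ih =>
    rw [ball, pow_succ']
    refine (Finset.card_biUnion_le_card_mul _ _ _ fun c hc => ih (Finset.mem_filter.1 hc).1).trans
      (Nat.mul_le_mul_right _ ?_)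
    have hsub : (B.filter fun c => b = c ∨ ¬ Disjoint (N b) (N c)) ⊆
        insert b ((N b).biUnion fun a => B.filter fun c => a ∈ N c) := by
      intro c hc
      obtain ⟨hcB, h⟩ := Finset.mem_filter.1 hc
      rcases h with rfl | h
      · exact Finset.mem_insert_self _ _
      · obtain ⟨a, hab, hac⟩ := Finset.not_disjoint_iff.1 h
        exact Finset.mem_insert_of_mem
          (Finset.mem_biUnion.2 ⟨a, hab, Finset.mem_filter.2 ⟨hcB, hac⟩⟩)
    refine (Finset.card_le_card hsub).trans ((Finset.card_insert_le _ _).trans ?_)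
    exact Nat.add_le_add_right ((Finset.card_biUnion_le_card_mul _ _ k fun a _ => hdeg a).trans
      (Nat.mul_le_mul_right _ (hN b hb))) 1

/-- There is a set of at most `s` elements of `B` with fewer neighbours than elements, which is
covered by a sequence of layers of size at most `w`, such that the layers that contain a given
element or neighbour are consecutive. -/
def HasNarrowImprovement (B : Finset β) (N : β → Finset α) (s w : ℕ) : Prop :=
  ∃ X ⊆ B, (X.biUnion N).card < X.card ∧ X.card ≤ s ∧ ∃ (m : ℕ) (Y : ℕ → Finset β),
    (∀ t, Y t ⊆ X) ∧ (∀ t, (Y t).card ≤ w) ∧ (∀ x ∈ X, ∃ t < m, x ∈ Y t) ∧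
    (∀ x i l j, i ≤ l → l ≤ j → x ∈ Y i → x ∈ Y j → x ∈ Y l) ∧
    (∀ a i l j, i ≤ l → l ≤ j → a ∈ (Y i).biUnion N → a ∈ (Y j).biUnion N → a ∈ (Y l).biUnion N)

/-- A set `R` of elements that are matched by `π` to elements with neighbours in `R` only. The
matched elements that are needed to pay for the neighbours in `R` of an element `b` are within
distance `i` of `b`. -/
structure Stage (A : Finset α) (B : Finset β) (N : β → Finset α) (i : ℕ) (R : Finset α)
    (π : α → β) : Prop where
  subset : R ⊆ A
  mem : ∀ a ∈ R, π a ∈ B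
  injOn : Set.InjOn π R
  nbhd_subset : ∀ a ∈ R, N (π a) ⊆ R
  exists_closed : ∀ b ∈ B, ∃ C ⊆ ball B N i b, b ∈ C ∧ (∀ y ∈ C, y = b ∨ y ∈ R.image π) ∧
    ∀ y ∈ C, ∀ a ∈ N y, a ∈ R → π a ∈ C

theorem stage_zero (A : Finset α) (B : Finset β) (N : β → Finset α) (π : α → β) :
    Stage A B N 0 ∅ π where
  subset := by simp
  mem := by simp
  injOn := by simp
  nbhd_subset := by simp
  exists_closed b _ := ⟨{b}, by simp [ball], by simp, by simp, by simp⟩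

/-- The unmatched elements with at most one neighbour outside `R`. -/
def lowDegree (B : Finset β) (N : β → Finset α) (R : Finset α) (π : α → β) : Finset β :=
  (B \ R.image π).filter fun b => (N b \ R).card ≤ 1

/-- `hsmall` excludes an unmatched element without neighbours outside `R`, and two low-degree
elements sharing their only one. Thus the low-degree elements are matched bijectively with new
neighbours, which are added to `R`. Paying for these new neighbours takes one more step in the
conflict graph, hence the radius `i + 1`. -/
theorem Stage.succ {A : Finset α} {i : ℕ} {R : Finset α} {π : α → β} (h : Stage A B N i R π)
    (hNA : ∀ b ∈ B, N b ⊆ A)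
    (hsmall : ∀ W ⊆ B \ R.image π, W.card ≤ 2 → W.card ≤ (W.biUnion fun b => N b \ R).card) :
    ∃ R' π', Stage A B N (i + 1) R' π' ∧ R'.card = R.card + (lowDegree B N R π).card := by
  classical
  set L := lowDegree B N R π with hL
  have hLB : ∀ b ∈ L, b ∈ B ∧ b ∉ R.image π ∧ (N b \ R).card ≤ 1 := fun b hb => by
    rw [hL, lowDegree, Finset.mem_filter, Finset.mem_sdiff] at hb
    exact ⟨hb.1.1, hb.1.2, hb.2⟩
  have hL1 : ∀ b ∈ L, (N b \ R).card = 1 := fun b hb => by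
    obtain ⟨h1, h2, h3⟩ := hLB b hb
    have := hsmall {b} (by simpa using ⟨h1, by simpa using h2⟩) (by simp)
    simp only [Finset.card_singleton, Finset.singleton_biUnion] at this
    omega
  have hLinj : ∀ b ∈ L, ∀ c ∈ L, ∀ a, a ∈ N b \ R → a ∈ N c \ R → b = c := by
    intro b hb c hc a hab hac
    by_contra hbc
    have hsub : ({b, c} : Finset β) ⊆ B \ R.image π := by
      intro x hx
      rw [Finset.mem_sdiff]
      rcases Finset.mem_insert.1 hx with rfl | hx
      · exact ⟨(hLB _ hb).1, (hLB _ hb).2.1⟩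
      · rw [Finset.mem_singleton.1 hx]
        exact ⟨(hLB _ hc).1, (hLB _ hc).2.1⟩
    have h2 := hsmall {b, c} hsub (Finset.card_pair hbc).le
    have hb1 : N b \ R = {a} := Finset.eq_singleton_iff_unique_mem.2
      ⟨hab, fun x hx => Finset.card_le_one.1 (hL1 b hb).le x hx a hab⟩
    have hc1 : N c \ R = {a} := Finset.eq_singleton_iff_unique_mem.2
      ⟨hac, fun x hx => Finset.card_le_one.1 (hL1 c hc).le x hx a hac⟩
    rw [Finset.card_pair hbc, Finset.biUnion_insert, Finset.singleton_biUnion, hb1, hc1] at h2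
    simp at h2
  set M := L.biUnion fun b => N b \ R with hM
  have hMcard : M.card = L.card := by
    rw [hM, Finset.card_biUnion, Finset.sum_congr rfl hL1]
    · simp
    · intro b hb c hc hbc
      refine Finset.disjoint_left.2 ?_
      exact fun a hab hac => hbc (hLinj b hb c hc a hab hac)
  have hMR : Disjoint R M := by
    rw [Finset.disjoint_right]
    intro a ha
    obtain ⟨b, -, hab⟩ := Finset.mem_biUnion.1 ha
    exact (Finset.mem_sdiff.1 hab).2
  have hpart : ∀ a, ∃ b, (a ∈ M → b ∈ L ∧ a ∈ N b \ R) ∧ (a ∉ M → b = π a) := by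
    intro a
    by_cases ha : a ∈ M
    · obtain ⟨b, hb, hab⟩ := Finset.mem_biUnion.1 ha
      exact ⟨b, fun _ => ⟨hb, hab⟩, fun h => absurd ha h⟩
    · exact ⟨π a, fun h => absurd h ha, fun _ => rfl⟩
  choose π' hπM hπR' using hpart
  have hπR : ∀ a ∈ R, π' a = π a := fun a ha => hπR' a (Finset.disjoint_left.1 hMR ha)
  have huniq : ∀ b ∈ L, ∀ a ∈ N b, a ∉ R → a ∈ M ∧ π' a = b := by
    intro b hb a hab haR
    have haM : a ∈ M := Finset.mem_biUnion.2 ⟨b, hb, Finset.mem_sdiff.2 ⟨hab, haR⟩⟩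
    exact ⟨haM, hLinj _ (hπM a haM).1 _ hb a (hπM a haM).2 (Finset.mem_sdiff.2 ⟨hab, haR⟩)⟩
  choose! C hCball hbC hCP hCcl using h.exists_closed
  refine ⟨R ∪ M, π', ⟨?_, ?_, ?_, ?_, ?_⟩, ?_⟩
  · refine Finset.union_subset h.subset (Finset.biUnion_subset.2 fun b hb => ?_)
    exact Finset.sdiff_subset.trans (hNA b (hLB b hb).1)
  · intro a ha
    rcases Finset.mem_union.1 ha with ha | ha
    · rw [hπR a ha]; exact h.mem a ha
    · exact (hLB _ (hπM a ha).1).1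
  · intro a ha c hc hac
    rw [Finset.mem_coe, Finset.mem_union] at ha hc
    have hmix : ∀ a ∈ R, ∀ c ∈ M, π' a ≠ π' c := by
      intro a ha c hc hac
      refine (hLB _ (hπM c hc).1).2.1 ?_
      rw [← hac, hπR a ha]
      exact Finset.mem_image_of_mem _ ha
    rcases ha with ha | ha <;> rcases hc with hc | hc
    · rw [hπR a ha, hπR c hc] at hac
      exact h.injOn ha hc hac
    · exact absurd hac (hmix a ha c hc)
    · exact absurd hac.symm (hmix c hc a ha)
    · have h1 := hπM a ha
      have h2 := hπM c hc
      rw [← hac] at h2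
      exact Finset.card_le_one.1 (hL1 _ h1.1).le a h1.2 c h2.2
  · intro a ha
    rcases Finset.mem_union.1 ha with ha | ha
    · rw [hπR a ha]
      exact (h.nbhd_subset a ha).trans Finset.subset_union_left
    · intro x hx
      by_cases hxR : x ∈ R
      · exact Finset.mem_union_left _ hxR
      · exact Finset.mem_union_right _ (huniq _ (hπM a ha).1 x hx hxR).1
  · intro b hb
    -- The new closed set of `b` joins to the old one those of the partners of the newly matched
    -- neighbours of `b`.
    set F := (N b).filter fun a => a ∈ M with hF
    have hFL : ∀ a ∈ F, π' a ∈ L ∧ a ∈ N b ∧ a ∈ N (π' a) := fun a ha => by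
      obtain ⟨h1, h2⟩ := Finset.mem_filter.1 ha
      exact ⟨(hπM a h2).1, h1, (Finset.mem_sdiff.1 (hπM a h2).2).1⟩
    have hroot : ∀ y ∈ C b ∪ F.biUnion (fun a => C (π' a)), ∃ c ∈ B, (c = b ∨ c ∈ L) ∧
        y ∈ C c ∧ C c ⊆ C b ∪ F.biUnion (fun a => C (π' a)) := by
      intro y hy
      rcases Finset.mem_union.1 hy with hy | hy
      · exact ⟨b, hb, Or.inl rfl, hy, Finset.subset_union_left⟩
      · obtain ⟨a, ha, hya⟩ := Finset.mem_biUnion.1 hy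
        exact ⟨π' a, (hLB _ (hFL a ha).1).1, Or.inr (hFL a ha).1, hya,
          (Finset.subset_biUnion_of_mem (fun a => C (π' a)) ha).trans Finset.subset_union_right⟩
    refine ⟨C b ∪ F.biUnion fun a => C (π' a), ?_, Finset.mem_union_left _ (hbC b hb), ?_, ?_⟩
    · refine Finset.union_subset ((hCball b hb).trans (ball_subset_ball_succ i hb))
        (Finset.biUnion_subset.2 fun a ha y hy => ?_)
      obtain ⟨h1, h2, h3⟩ := hFL a ha
      exact mem_ball_succ (hLB _ h1).1 (Or.inr (Finset.not_disjoint_iff.2 ⟨a, h2, h3⟩))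
        (hCball _ (hLB _ h1).1 hy)
    · have himg : ∀ y ∈ R.image π, y ∈ (R ∪ M).image π' := by
        intro y hy
        obtain ⟨a, ha, rfl⟩ := Finset.mem_image.1 hy
        rw [← hπR a ha]
        exact Finset.mem_image_of_mem _ (Finset.mem_union_left _ ha)
      intro y hy
      rcases Finset.mem_union.1 hy with hy | hy
      · exact (hCP b hb y hy).imp_right (himg y)
      · obtain ⟨a, ha, hya⟩ := Finset.mem_biUnion.1 hy
        refine Or.inr ?_
        rcases hCP _ (hLB _ (hFL a ha).1).1 y hya with rfl | hy'
        · exact Finset.mem_image_of_mem _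
            (Finset.mem_union_right _ (Finset.mem_filter.1 ha).2)
        · exact himg y hy'
    · intro y hy a hay haRM
      obtain ⟨c, hcB, hc, hyc, hsub⟩ := hroot y hy
      by_cases haR : a ∈ R
      · rw [hπR a haR]
        exact hsub (hCcl c hcB y hyc a hay haR)
      · have haM : a ∈ M := (Finset.mem_union.1 haRM).resolve_left haR
        -- Elements of an old closed set other than its centre have all their neighbours in `R`, so
        -- only the centre can see `M`.
        have hyc' : y = c := by
          refine (hCP c hcB y hyc).resolve_right fun hyP => ?_
          obtain ⟨x, hx, rfl⟩ := Finset.mem_image.1 hyP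
          exact haR (h.nbhd_subset x hx hay)
        subst hyc'
        rcases hc with rfl | hc
        · exact Finset.mem_union_right _ (Finset.mem_biUnion.2
            ⟨a, Finset.mem_filter.2 ⟨hay, haM⟩, hbC _ (hLB _ (hπM a haM).1).1⟩)
        · rw [(huniq y hc a hay haR).2]
          exact hy
  · rw [Finset.card_union_of_disjoint hMR, hMcard]

/-- A layered set of edges with few ends outside `R` yields a narrow improvement. -/
theorem Stage.hasNarrowImprovement {A : Finset α} {i : ℕ} {R : Finset α} {π : α → β}
    (h : Stage A B N i R π) {c d T : ℕ} (hc : ∀ b ∈ B, (ball B N i b).card ≤ c)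
    {Z W : Finset β} {δ : β → ℕ} (hZ : Z ⊆ B \ R.image π) (hW : W ⊆ B \ R.image π)
    (hW2 : W.card ≤ 2)
    (hlt : ((Z ∪ W).biUnion fun b => N b \ R).card < (Z ∪ W).card)
    (hδT : ∀ z ∈ Z, δ z ≤ T) (hδ4 : ∀ s, (Z.filter fun z => δ z = s).card ≤ 4)
    (hδ : ∀ z ∈ Z, ∀ z' ∈ Z, z' ∈ ball B N (2 * i + 1) z → δ z' ≤ δ z + d) :
    HasNarrowImprovement B N (c * (4 * (T + 1) + 2)) (c * (4 * (d + 1) + 2)) := by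
  classical
  choose! C hCball hbC hCP hCcl using h.exists_closed
  have hZB : ∀ z ∈ Z, z ∈ B := fun z hz => (Finset.mem_sdiff.1 (hZ hz)).1
  have hWB : ∀ z ∈ W, z ∈ B := fun z hz => (Finset.mem_sdiff.1 (hW hz)).1
  have hXB : ∀ x ∈ Z ∪ W, x ∈ B ∧ x ∉ R.image π := fun x hx =>
    Finset.mem_sdiff.1 (Finset.union_subset hZ hW hx)
  have hCcard : ∀ b ∈ B, (C b).card ≤ c := fun b hb =>
    (Finset.card_le_card (hCball b hb)).trans (hc b hb)
  have hfib : ∀ (S : Finset ℕ) (Z' : Finset β), Z' ⊆ Z → (∀ z ∈ Z', δ z ∈ S) →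
      Z'.card ≤ 4 * S.card := fun S Z' hZ' hS =>
    Finset.card_le_mul_card_image_of_maps_to hS 4 fun s _ =>
      (Finset.card_le_card (Finset.filter_subset_filter _ hZ')).trans (hδ4 s)
  have hbound : ∀ (S : Finset ℕ) (Z' : Finset β), Z' ⊆ Z → (∀ z ∈ Z', δ z ∈ S) →
      ((Z' ∪ W).biUnion C).card ≤ c * (4 * S.card + 2) := by
    intro S Z' hZ' hS
    refine (Finset.card_biUnion_le_card_mul _ _ c fun b hb => hCcard b ?_).trans ?_
    · exact (Finset.mem_union.1 hb).elim (fun hb => hZB b (hZ' hb)) (hWB b)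
    · rw [mul_comm]
      exact Nat.mul_le_mul_left _ ((Finset.card_union_le _ _).trans
        (add_le_add (hfib S Z' hZ' hS) hW2))
  -- A window of `d + 1` depths, at most four edges each; `W` is added to every layer, since its
  -- depths are not controlled.
  set layer : ℕ → Finset β := fun t => Z.filter fun z => t ≤ δ z ∧ δ z ≤ t + d with hlayer
  have hlayerZ : ∀ t, layer t ⊆ Z := fun t => Finset.filter_subset _ _
  -- Closed sets of radius `i` that touch have centres at distance at most `i + 1 + i`, hence the
  -- conflict radius `2 * i + 1`.
  have hnear : ∀ z ∈ Z, ∀ z' ∈ Z, ∀ y ∈ C z, ∀ y' ∈ C z', (y = y' ∨ ¬ Disjoint (N y) (N y')) →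
      δ z' ≤ δ z + d := by
    intro z hz z' hz' y hy y' hy' hyy'
    refine hδ z hz z' hz' ?_
    have h1 := hCball z (hZB z hz) hy
    have h2 := mem_ball_symm (hZB z' hz') (hCball z' (hZB z' hz') hy')
    have h3 := mem_ball_one (ball_subset i (hZB z' hz') (hCball z' (hZB z' hz') hy')) hyy'
    have h4 := mem_ball_add (mem_ball_add h1 h3) h2
    rwa [show i + 1 + i = 2 * i + 1 by ring] at h4
  have hbetween : ∀ (y y' : β) (i l j : ℕ), i ≤ l → l ≤ j → (y = y' ∨ ¬ Disjoint (N y) (N y')) →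
      y ∈ (layer i ∪ W).biUnion C → y' ∈ (layer j ∪ W).biUnion C →
      y ∈ (layer l ∪ W).biUnion C ∨ y' ∈ (layer l ∪ W).biUnion C := by
    intro y y' i l j hil hlj hyy' hy hy'
    obtain ⟨z, hz, hyz⟩ := Finset.mem_biUnion.1 hy
    obtain ⟨z', hz', hyz'⟩ := Finset.mem_biUnion.1 hy'
    rcases Finset.mem_union.1 hz with hz | hz
    swap
    · exact Or.inl (Finset.mem_biUnion.2 ⟨z, Finset.mem_union_right _ hz, hyz⟩)
    rcases Finset.mem_union.1 hz' with hz' | hz'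
    swap
    · exact Or.inr (Finset.mem_biUnion.2 ⟨z', Finset.mem_union_right _ hz', hyz'⟩)
    simp only [hlayer, Finset.mem_filter] at hz hz'
    have hle := hnear z hz.1 z' hz'.1 y hyz y' hyz' hyy'
    by_cases hl : l ≤ δ z
    · exact Or.inl (Finset.mem_biUnion.2 ⟨z, Finset.mem_union_left _
        (Finset.mem_filter.2 ⟨hz.1, hl, by omega⟩), hyz⟩)
    -- Now `δ z < l ≤ j ≤ δ z'`, and `δ z' ≤ δ z + d` puts `z'` into the window at `l`.
    · exact Or.inr (Finset.mem_biUnion.2 ⟨z', Finset.mem_union_left _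
        (Finset.mem_filter.2 ⟨hz'.1, by omega, by omega⟩), hyz'⟩)
  set X := (Z ∪ W).biUnion C with hX
  have hXX : Z ∪ W ⊆ X := fun x hx => Finset.mem_biUnion.2 ⟨x, hx, hbC x (hXB x hx).1⟩
  refine ⟨X, Finset.biUnion_subset.2 fun b hb =>
    (hCball b (hXB b hb).1).trans (ball_subset i (hXB b hb).1), ?_, ?_, T + 1,
    fun t => (layer t ∪ W).biUnion C, ?_, ?_, ?_, ?_, ?_⟩
  -- Neighbours in `R` are paid for, through the injection `π`, by the added elements `X \ (Z ∪ W)`;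
  -- those outside `R` come from `Z ∪ W` alone and are too few by `hlt`.
  · have hsub : X.biUnion N ⊆ ((Z ∪ W).biUnion fun b => N b \ R) ∪
        R.filter fun a => π a ∈ X := by
      intro a ha
      obtain ⟨y, hy, hay⟩ := Finset.mem_biUnion.1 ha
      obtain ⟨b, hb, hyb⟩ := Finset.mem_biUnion.1 hy
      rw [Finset.mem_union]
      by_cases haR : a ∈ R
      · exact Or.inr (Finset.mem_filter.2 ⟨haR, Finset.mem_biUnion.2
          ⟨b, hb, hCcl b (hXB b hb).1 y hyb a hay haR⟩⟩)
      · rcases hCP b (hXB b hb).1 y hyb with rfl | hyP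
        · exact Or.inl (Finset.mem_biUnion.2 ⟨y, hb, Finset.mem_sdiff.2 ⟨hay, haR⟩⟩)
        · obtain ⟨x, hx, rfl⟩ := Finset.mem_image.1 hyP
          exact absurd (h.nbhd_subset x hx hay) haR
    have himg : (R.filter fun a => π a ∈ X).card ≤ (X \ (Z ∪ W)).card := by
      refine Finset.card_le_card_of_injOn π (fun a ha => ?_) fun a ha c hc hac => ?_
      · rw [Finset.mem_coe, Finset.mem_filter] at ha
        exact Finset.mem_coe.2 (Finset.mem_sdiff.2
          ⟨ha.2, fun hx => (hXB _ hx).2 (Finset.mem_image_of_mem _ ha.1)⟩)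
      · exact h.injOn (Finset.mem_filter.1 (Finset.mem_coe.1 ha)).1
          (Finset.mem_filter.1 (Finset.mem_coe.1 hc)).1 hac
    have h1 := (Finset.card_le_card hsub).trans (Finset.card_union_le _ _)
    have h2 := Finset.card_sdiff_add_card_eq_card hXX
    omega
  · have := hbound (Finset.range (T + 1)) Z subset_rfl fun z hz =>
      Finset.mem_range.2 (Nat.lt_succ_of_le (hδT z hz))
    rwa [Finset.card_range] at this
  · exact fun t => Finset.biUnion_subset_biUnion_of_subset_left _
      (Finset.union_subset_union_left (hlayerZ t))
  · intro t
    have := hbound (Finset.Icc t (t + d)) (layer t) (hlayerZ t) fun z hz =>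
      Finset.mem_Icc.2 (Finset.mem_filter.1 hz).2
    rwa [Nat.card_Icc, show t + d + 1 - t = d + 1 by omega] at this
  · intro x hx
    obtain ⟨z, hz, hxz⟩ := Finset.mem_biUnion.1 hx
    rcases Finset.mem_union.1 hz with hz | hz
    · exact ⟨δ z, Nat.lt_succ_of_le (hδT z hz), Finset.mem_biUnion.2 ⟨z, Finset.mem_union_left _
        (Finset.mem_filter.2 ⟨hz, le_rfl, by omega⟩), hxz⟩⟩
    · exact ⟨0, Nat.succ_pos _, Finset.mem_biUnion.2 ⟨z, Finset.mem_union_right _ hz, hxz⟩⟩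
  · intro x i l j hil hlj hi hj
    exact (hbetween x x i l j hil hlj (Or.inl rfl) hi hj).elim id id
  · intro a i l j hil hlj hi hj
    obtain ⟨y, hy, hay⟩ := Finset.mem_biUnion.1 hi
    obtain ⟨y', hy', hay'⟩ := Finset.mem_biUnion.1 hj
    rcases hbetween y y' i l j hil hlj (Or.inr (Finset.not_disjoint_iff.2 ⟨a, hay, hay'⟩))
      hy hy' with h | h
    · exact Finset.mem_biUnion.2 ⟨y, h, hay⟩
    · exact Finset.mem_biUnion.2 ⟨y', h, hay'⟩

/-- Iterating `Stage.succ` leads to a stage with few unmatched elements of degree one. -/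
theorem exists_stage_card_lowDegree_le [Nonempty β] {A : Finset α} {ε : ℝ} {I : ℕ} (hI : 1 ≤ I * ε)
    (hε : 0 < ε) (hNA : ∀ b ∈ B, N b ⊆ A)
    (hsmall : ∀ i ≤ I, ∀ R π, Stage A B N i R π → ∀ W ⊆ B \ R.image π, W.card ≤ 2 →
      W.card ≤ (W.biUnion fun b => N b \ R).card) :
    ∃ i ≤ I, ∃ R π, Stage A B N i R π ∧ ((lowDegree B N R π).card : ℝ) ≤ ε * A.card := by
  by_contra! hcon
  -- If each round gained more than `ε|A|`, then `R` would fill `A` after `I` rounds, and one more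
  -- round would overflow it.
  have key : ∀ j ≤ I, ∃ R π, Stage A B N j R π ∧ j * ε * A.card ≤ (R.card : ℝ) := by
    intro j
    induction j with
    | zero => exact fun _ => ⟨∅, fun _ => Classical.arbitrary β, stage_zero A B N _, by simp⟩
    | succ j ih =>
      intro hj
      obtain ⟨R, π, hst, hR⟩ := ih (by omega)
      obtain ⟨R', π', hst', hR'⟩ := hst.succ hNA (hsmall j (by omega) R π hst)
      refine ⟨R', π', hst', ?_⟩
      have := hcon j (by omega) R π hst
      rw [hR']
      push_cast
      linarith
  obtain ⟨R, π, hst, hR⟩ := key I le_rfl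
  obtain ⟨R', π', hst', hR'⟩ := hst.succ hNA (hsmall I le_rfl R π hst)
  have h1 := hcon I le_rfl R π hst
  have h2 : (R.card : ℝ) + (lowDegree B N R π).card ≤ A.card := by
    exact_mod_cast hR' ▸ Finset.card_le_card hst'.subset
  have h3 : (0 : ℝ) ≤ A.card := Nat.cast_nonneg _
  nlinarith [mul_le_mul_of_nonneg_right hI h3, mul_nonneg hε.le h3]

/-- After peeling, degree-one elements number at most `ε|A|` and degree-two elements at most `(1 +
ε)|A \ R|`, so the degree count bounds the unmatched part. The matched part adds at most `|R|`,
which is affordable as `(k + 1)/3 ≥ 1`. -/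
theorem card_le_of_not_hasNarrowImprovement {A : Finset α} {k I d T c : ℕ} (hk : 2 ≤ k) {ε : ℝ}
    (hε : 0 < ε) (hI : 1 ≤ I * ε)
    (hd : (((k * k + 1) ^ (2 * I + 1) : ℕ) : ℝ) ≤ ε / 2 * (1 + ε / 2) ^ d)
    (hc : (k * k + 1) ^ I ≤ c) (hT : (A.card : ℝ) < (1 + ε / 2) ^ T)
    (hNA : ∀ b ∈ B, N b ⊆ A) (hN : ∀ b ∈ B, (N b).card ≤ k)
    (hdeg : ∀ a ∈ A, (B.filter fun b => a ∈ N b).card ≤ k)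
    (hno : ¬ HasNarrowImprovement B N (c * (4 * (T + 1) + 2)) (c * (4 * (d + 1) + 2))) :
    (B.card : ℝ) ≤ (((k : ℝ) + 1) / 3 + ε) * A.card := by
  rcases B.eq_empty_or_nonempty with rfl | ⟨b₀, -⟩
  · simp only [Finset.card_empty, Nat.cast_zero]
    positivity
  have : Nonempty β := ⟨b₀⟩
  have hdeg' : ∀ a, (B.filter fun b => a ∈ N b).card ≤ k := by
    intro a
    by_cases ha : a ∈ A
    · exact hdeg a ha
    · rw [Finset.filter_false_of_mem fun b hb hab => ha (hNA b hb hab)]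
      simp
  have hball : ∀ i ≤ I, ∀ b ∈ B, (ball B N i b).card ≤ c := fun i hi b hb =>
    ((card_ball_le hN hdeg' i hb).trans (Nat.pow_le_pow_right (by omega) hi)).trans hc
  have hsmall : ∀ i ≤ I, ∀ R π, Stage A B N i R π → ∀ W ⊆ B \ R.image π, W.card ≤ 2 →
      W.card ≤ (W.biUnion fun b => N b \ R).card := by
    intro i hi R π hst W hW hW2
    by_contra! hlt
    -- A bad set of at most two elements is an improvement consisting of exceptional elements only.
    exact hno (hst.hasNarrowImprovement (Z := ∅) (δ := fun _ => 0) (hball i hi) (by simp) hW hW2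
      (by simpa using hlt) (by simp) (by simp) (by simp))
  obtain ⟨i, hi, R, π, hst, hlow⟩ := exists_stage_card_lowDegree_le hI hε hNA hsmall
  set B' := B \ R.image π with hB'
  set N' : β → Finset α := fun b => N b \ R with hN'
  set E := B'.filter fun b => (N' b).card = 2 with hE
  have hEB' : E ⊆ B' := Finset.filter_subset _ _
  have hB'B : B' ⊆ B := Finset.sdiff_subset
  have hE2 : ∀ e ∈ E, (N' e).card = 2 := fun e he => (Finset.mem_filter.1 he).2
  have hN'A : ∀ b ∈ B', N' b ⊆ A \ R := fun b hb =>
    Finset.sdiff_subset_sdiff (hNA b (hB'B hb)) subset_rfl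
  have hEcard : (E.card : ℝ) ≤ (1 + ε) * (A \ R).card := by
    rcases (A \ R).eq_empty_or_nonempty with h0 | h0
    · have : E = ∅ := by
        refine Finset.eq_empty_of_forall_notMem fun e he => ?_
        have h1 := Finset.card_le_card (hN'A e (hEB' he))
        rw [hE2 e he, h0] at h1
        simp at h1
      rw [this, h0]
      simp
    · by_contra! hlt
      -- Elements with two neighbours outside `R` are the edges, and two edges conflict when their
      -- closed sets could touch.
      obtain ⟨Z, W, δ, hZ, hW, hW2, hZW, hδT, hδ4, hδ⟩ := exists_layered_of_dense
        (K := ball B N (2 * i + 1)) (T := T) hε (fun e he => hN'A e (hEB' he))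
        (fun e he => (hE2 e he).le) (fun e he => Finset.card_pos.1 (by rw [hE2 e he]; simp))
        (fun e he => (card_ball_le hN hdeg' _ (hB'B (hEB' he))).trans
          (Nat.pow_le_pow_right (by omega) (show 2 * i + 1 ≤ 2 * I + 1 by omega))) hd
        (lt_of_le_of_lt (by exact_mod_cast Finset.card_le_card Finset.sdiff_subset) hT) h0 hlt.le
      exact hno (hst.hasNarrowImprovement (hball i hi) (hZ.trans hEB') (hW.trans hEB') hW2 hZW
        hδT hδ4 hδ)
  have h3 := three_mul_card_le (k := k) hN'A (fun b hb => by
      have := hsmall i hi R π hst {b} (Finset.singleton_subset_iff.2 hb) (by simp)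
      rw [Finset.card_singleton, Finset.singleton_biUnion] at this
      exact Finset.card_pos.1 this)
    (fun a _ => (Finset.card_le_card fun b hb => by
      rw [Finset.mem_filter] at hb ⊢
      exact ⟨hB'B hb.1, (Finset.mem_sdiff.1 hb.2).1⟩).trans (hdeg' a))
  have h3' : 3 * (B'.card : ℝ) ≤ k * (A \ R).card + 2 * (lowDegree B N R π).card + E.card := by
    exact_mod_cast h3
  have h4 : (B.card : ℝ) ≤ R.card + B'.card := by
    have h5 : B.card - (R.image π).card ≤ B'.card := Finset.le_card_sdiff (R.image π) B
    have h6 : (R.image π).card ≤ R.card := Finset.card_image_le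
    have : B.card ≤ R.card + B'.card := by omega
    exact_mod_cast this
  have h5 : ((A \ R).card : ℝ) + R.card = A.card := by
    exact_mod_cast Finset.card_sdiff_add_card_eq_card hst.subset
  have hk' : (2 : ℝ) ≤ k := by exact_mod_cast hk
  have h6 : (0 : ℝ) ≤ R.card := Nat.cast_nonneg _
  rw [← h5] at hlow ⊢
  nlinarith [mul_nonneg (sub_nonneg.2 hk') h6, mul_nonneg hε.le h6]

end Ball

/-- Each point of `S` lies in at most one member of `D`. This gives the degree bound `k` on both
sides of the conflict graph. -/
theorem card_filter_le_of_isDisjointFamily {U : Type*} [DecidableEq U] {D : Finset (Finset U)}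
    (hD : IsDisjointFamily D) (S : Finset U) (p : Finset U → Prop) [DecidablePred p]
    (hp : ∀ T ∈ D, p T → ¬ Disjoint S T) : (D.filter p).card ≤ S.card := by
  have hsub : D.filter p ⊆ S.biUnion fun x => D.filter fun T => x ∈ T := by
    intro T hT
    rw [Finset.mem_filter] at hT
    obtain ⟨x, hxS, hxT⟩ := Finset.not_disjoint_iff.1 (hp T hT.1 hT.2)
    exact Finset.mem_biUnion.2 ⟨x, hxS, Finset.mem_filter.2 ⟨hT.1, hxT⟩⟩
  refine (Finset.card_le_card hsub).trans
    ((Finset.card_biUnion_le_card_mul _ _ 1 fun x _ => Finset.card_le_one.2 ?_).trans (by simp))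
  intro T hT T' hT'
  rw [Finset.mem_filter] at hT hT'
  by_contra hne
  exact Finset.disjoint_left.1 (hD T hT.1 T' hT'.1 hne) hT.2 hT'.2

/-! ### From narrow improvements to improving sets of bounded pathwidth. -/

section Translation

variable {U : Type*} {F F₀ X : Finset (Finset U)}
  {N : Finset U → Finset (Finset U)}

theorem conflictGraph_adj_iff (hX0 : ∀ S ∈ X, S ∉ F₀)
    (hN : ∀ S ∈ X, ∀ T, T ∈ N S ↔ T ∈ F₀ ∧ ¬ Disjoint S T) {S T : F} (hS : S.1 ∈ X) :
    (conflictGraph F F₀).Adj S T ↔ T.1 ∈ N S.1 := by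
  rw [hN _ hS]
  have := hX0 _ hS
  simp only [conflictGraph]
  tauto

theorem mem_closedNbhd_iff [DecidableEq U] (hX0 : ∀ S ∈ X, S ∉ F₀) (hXF : X ⊆ F)
    (hN : ∀ S ∈ X, ∀ T, T ∈ N S ↔ T ∈ F₀ ∧ ¬ Disjoint S T) (T : F) :
    T ∈ (conflictGraph F F₀).closedNbhd {S | S.1 ∈ X} ↔ T.1 ∈ X ∨ T.1 ∈ X.biUnion N := by
  simp only [SimpleGraph.closedNbhd, Set.mem_iUnion, Set.mem_ofPred_eq, Set.mem_insert_iff,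
    SimpleGraph.mem_neighborSet, Finset.mem_biUnion]
  constructor
  · rintro ⟨S, hS, rfl | hST⟩
    · exact Or.inl hS
    · exact Or.inr ⟨S.1, hS, (conflictGraph_adj_iff hX0 hN hS).1 hST⟩
  · rintro (hT | ⟨S, hS, hT⟩)
    · exact ⟨T, hT, Or.inl rfl⟩
    · exact ⟨⟨S, hXF hS⟩, hS, Or.inr ((conflictGraph_adj_iff hX0 hN (S := ⟨S, hXF hS⟩) hS).2 hT)⟩

theorem ncard_setOf_mem {G : Finset (Finset U)} (hG : G ⊆ F) :
    {S : F | S.1 ∈ G}.ncard = G.card := by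
  rw [← Set.ncard_coe_finset, ← Set.ncard_image_of_injective _ Subtype.val_injective]
  congr 1
  ext S
  simpa using fun h => hG h

theorem isImprovingSet_setOf_mem [DecidableEq U] (hX0 : ∀ S ∈ X, S ∉ F₀) (hXF : X ⊆ F)
    (hF₀ : F₀ ⊆ F)
    (hN : ∀ S ∈ X, ∀ T, T ∈ N S ↔ T ∈ F₀ ∧ ¬ Disjoint S T) (hX : IsDisjointFamily X)
    (hlt : (X.biUnion N).card < X.card) : IsImprovingSet F F₀ {S | S.1 ∈ X} where
  notMem S hS := hX0 _ hS
  disjoint S hS T hT hST := hX _ hS _ hT fun h => hST (Subtype.ext h)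
  ncard_lt := by
    have hNX : X.biUnion N ⊆ F₀ := by
      refine Finset.biUnion_subset.2 fun S hS T hT => ((hN S hS T).1 hT).1
    have h : (conflictGraph F F₀).openNbhd {S | S.1 ∈ X} = {T : F | T.1 ∈ X.biUnion N} := by
      ext T
      rw [SimpleGraph.openNbhd, Set.mem_sdiff, mem_closedNbhd_iff hX0 hXF hN, Set.mem_ofPred_eq,
        Set.mem_ofPred_eq]
      constructor
      · exact fun h => h.1.resolve_left h.2
      · exact fun h => ⟨Or.inr h, fun hTX => hX0 _ hTX (hNX h)⟩
    rw [h, ncard_setOf_mem (hNX.trans hF₀), ncard_setOf_mem hXF]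
    exact hlt

/-- The bags are the layers together with their neighbours, of size at most `w + w * k`. Every edge
has an end in `X`, so a layer containing that end has a bag covering the edge. -/
theorem improvingPathwidth_le [DecidableEq U] (hX0 : ∀ S ∈ X, S ∉ F₀) (hXF : X ⊆ F)
    (hN : ∀ S ∈ X, ∀ T, T ∈ N S ↔ T ∈ F₀ ∧ ¬ Disjoint S T) {k w m : ℕ}
    (hk : ∀ S ∈ X, (N S).card ≤ k) (Y : ℕ → Finset (Finset U)) (hYX : ∀ t, Y t ⊆ X)
    (hYw : ∀ t, (Y t).card ≤ w) (hcov : ∀ S ∈ X, ∃ t < m, S ∈ Y t)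
    (hY : ∀ x i l j, i ≤ l → l ≤ j → x ∈ Y i → x ∈ Y j → x ∈ Y l)
    (hYN : ∀ a i l j, i ≤ l → l ≤ j → a ∈ (Y i).biUnion N → a ∈ (Y j).biUnion N →
      a ∈ (Y l).biUnion N) :
    improvingPathwidth F F₀ {S | S.1 ∈ X} ≤ (w * (k + 1) : ℕ) := by
  have hYF : ∀ t, ∀ T ∈ (Y t).biUnion N, T ∈ F₀ := fun t T hT => by
    obtain ⟨S, hS, hTS⟩ := Finset.mem_biUnion.1 hT
    exact ((hN S (hYX t hS) T).1 hTS).1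
  have hadj : ∀ S T : F, S.1 ∈ X → (conflictGraph F F₀).Adj S T →
      ∃ t < m, S.1 ∈ Y t ∧ T.1 ∈ (Y t).biUnion N := by
    intro S T hS hST
    obtain ⟨t, ht, hSt⟩ := hcov _ hS
    exact ⟨t, ht, hSt, Finset.mem_biUnion.2 ⟨S.1, hSt, (conflictGraph_adj_iff hX0 hN hS).1 hST⟩⟩
  let D : ((conflictGraph F F₀).induce
      ((conflictGraph F F₀).closedNbhd {S | S.1 ∈ X})).PathDecomposition :=
    { length := m
      bag := fun t => {v | v.1.1 ∈ Y t ∪ (Y t).biUnion N}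
      iUnion_bag := by
        refine Set.eq_univ_of_forall fun v => Set.mem_iUnion.2 ?_
        rcases (mem_closedNbhd_iff hX0 hXF hN v.1).1 v.2 with h | h
        · obtain ⟨t, ht, hv⟩ := hcov _ h
          exact ⟨⟨t, ht⟩, Finset.mem_union_left _ hv⟩
        · obtain ⟨S, hS, hv⟩ := Finset.mem_biUnion.1 h
          obtain ⟨t, ht, hSt⟩ := hcov _ hS
          exact ⟨⟨t, ht⟩, Finset.mem_union_right _ (Finset.mem_biUnion.2 ⟨S, hSt, hv⟩)⟩
      exists_bag_of_adj := by
        intro u v huv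
        rw [SimpleGraph.induce_adj] at huv
        rcases (mem_closedNbhd_iff hX0 hXF hN u.1).1 u.2 with h | h
        · obtain ⟨t, ht, h1, h2⟩ := hadj _ _ h huv
          exact ⟨⟨t, ht⟩, Finset.mem_union_left _ h1, Finset.mem_union_right _ h2⟩
        rcases (mem_closedNbhd_iff hX0 hXF hN v.1).1 v.2 with h' | h'
        · obtain ⟨t, ht, h1, h2⟩ := hadj _ _ h' huv.symm
          exact ⟨⟨t, ht⟩, Finset.mem_union_right _ h2, Finset.mem_union_left _ h1⟩
        · exfalso
          obtain ⟨S, hS, hu⟩ := Finset.mem_biUnion.1 h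
          obtain ⟨S', hS', hv⟩ := Finset.mem_biUnion.1 h'
          have h1 := ((hN S hS _).1 hu).1
          have h2 := ((hN S' hS' _).1 hv).1
          rcases huv.1 with h3 | h3
          · exact h3.2 h2
          · exact h3.2 h1
      mem_bag_of_between := by
        intro v i l j hil hlj hi hj
        simp only [Set.mem_ofPred_eq, Finset.mem_union] at hi hj ⊢
        -- Members of `F₀` occur in bags only as neighbours, other sets only as layer elements, so
        -- the two consecutiveness conditions do not mix.
        by_cases hv : v.1.1 ∈ F₀
        · have hnot : ∀ t, v.1.1 ∉ Y t := fun t ht => hX0 _ (hYX t ht) hv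
          exact Or.inr (hYN _ i l j hil hlj (hi.resolve_left (hnot _)) (hj.resolve_left (hnot _)))
        · have hnot : ∀ t, v.1.1 ∉ (Y t).biUnion N := fun t ht => hv (hYF t _ ht)
          exact Or.inl (hY _ i l j hil hlj (hi.resolve_right (hnot _))
            (hj.resolve_right (hnot _))) }
  refine (iInf_le _ D).trans (tsub_le_self.trans (iSup_le fun t => ?_))
  have hinj : Function.Injective
      fun v : (conflictGraph F F₀).closedNbhd {S : F | S.1 ∈ X} => v.1.1 :=
    Subtype.val_injective.comp Subtype.val_injective
  have himg : (D.bag t).encard ≤ ((Y t ∪ (Y t).biUnion N : Finset _) : Set (Finset U)).encard := by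
    rw [← hinj.encard_image]
    refine Set.encard_le_encard ?_
    rintro _ ⟨v, hv, rfl⟩
    exact hv
  refine himg.trans ?_
  rw [Set.encard_coe_eq_coe_finsetCard, Nat.cast_le]
  have h1 := Finset.card_union_le (Y t) ((Y t).biUnion N)
  have h2 := Finset.card_biUnion_le_card_mul (Y t) N k fun S hS => hk S (hYX t hS)
  have h3 := Nat.mul_le_mul_right (k + 1) (hYw t)
  rw [mul_add, mul_one] at h3
  omega

end Translation

end SetPacking

/-! ### Choice of constants and the main theorem. -/

theorem mainTheorem3 (k : ℕ) (hk : 2 ≤ k) (ε : ℝ) (hε : 0 < ε) :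
    ∃ (c₁ : ℝ) (c₂ : ℕ), ∀ (U : Type*) (F F₀ OPT : Finset (Finset U)),
      2 ≤ F.card →
      (∀ S ∈ F, S.card ≤ k) →
      F₀ ⊆ F →
      SetPacking.IsDisjointFamily F₀ →
      (¬ ∃ X : Set F, SetPacking.IsImprovingSet F F₀ X ∧
        (X.ncard : ℝ) ≤ c₁ * Real.log F.card ∧
        SetPacking.improvingPathwidth F F₀ X ≤ c₂) →
      SetPacking.IsMaximumDisjointSubfamily F OPT →
      (OPT.card : ℝ) ≤ (((k : ℝ) + 1) / 3 + ε) * F₀.card := by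
  classical
  obtain ⟨I, hI⟩ := exists_nat_ge (1 / ε)
  rw [div_le_iff₀ hε] at hI
  have hbase : 1 < 1 + ε / 2 := by linarith
  obtain ⟨d, hd⟩ := pow_unbounded_of_one_lt
    ((((k * k + 1) ^ (2 * I + 1) : ℕ) : ℝ) / (ε / 2)) hbase
  rw [div_lt_iff₀' (by positivity)] at hd
  set c := (k * k + 1) ^ I with hc
  set μ := Real.log (1 + ε / 2) with hμ
  have hμ0 : 0 < μ := Real.log_pos hbase
  have hlog2 : 0 < Real.log 2 := Real.log_pos (by norm_num)
  -- With `T ≤ log n / μ + 1`, the size factor `4 * (T + 1) + 2` is at most `4 * log n / μ + 10`;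
  -- since `n ≥ 2`, the constant 10 is absorbed by `10 * log n / log 2`.
  refine ⟨c * (4 / μ + 10 / Real.log 2), (c * (4 * (d + 1) + 2)) * (k + 1), ?_⟩
  intro U F F₀ OPT hF hFk hF₀ hdisj hno hOPT
  set n := F.card with hn
  have hn2 : (2 : ℝ) ≤ n := by exact_mod_cast hF
  have hlogn : Real.log 2 ≤ Real.log n := Real.log_le_log (by norm_num) hn2
  set T := ⌊Real.log n / μ⌋₊ + 1 with hT
  have hTn : (n : ℝ) < (1 + ε / 2) ^ T := by
    rw [← Real.log_lt_log_iff (by linarith) (by positivity), Real.log_pow, ← hμ,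
      ← div_lt_iff₀ hμ0]
    have := Nat.lt_floor_add_one (Real.log n / μ)
    rw [hT]
    exact_mod_cast this
  have hTle : (T : ℝ) ≤ Real.log n / μ + 1 := by
    rw [hT, Nat.cast_add, Nat.cast_one]
    exact add_le_add_left (Nat.floor_le (div_nonneg (hlog2.le.trans hlogn) hμ0.le)) 1
  set A := F₀ \ OPT with hA
  set B := OPT \ F₀ with hB
  set N : Finset U → Finset (Finset U) := fun S => A.filter fun T => ¬ Disjoint S T with hN
  have hBF : B ⊆ F := Finset.sdiff_subset.trans hOPT.subset
  have hNiff : ∀ S ∈ B, ∀ T, T ∈ N S ↔ T ∈ F₀ ∧ ¬ Disjoint S T := by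
    intro S hS T
    rw [Finset.mem_sdiff] at hS
    simp only [hN, hA, Finset.mem_filter, Finset.mem_sdiff]
    -- Restricting to `A` loses no neighbours: a member of `OPT ∩ F₀` is disjoint from every set in
    -- `B`.
    refine ⟨fun h => ⟨h.1.1, h.2⟩, fun h => ⟨⟨h.1, fun hT => h.2 ?_⟩, h.2⟩⟩
    exact hOPT.disjoint S hS.1 T hT fun hST => hS.2 (hST ▸ h.1)
  have hNk : ∀ S ∈ B, (N S).card ≤ k := fun S hS =>
    (SetPacking.card_filter_le_of_isDisjointFamily
      (fun P hP Q hQ => hdisj P (Finset.mem_sdiff.1 hP).1 Q (Finset.mem_sdiff.1 hQ).1) S _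
      fun _ _ h => h).trans (hFk S (hBF hS))
  have hdeg : ∀ T ∈ A, (B.filter fun S => T ∈ N S).card ≤ k := fun T hT =>
    (SetPacking.card_filter_le_of_isDisjointFamily
      (fun P hP Q hQ => hOPT.disjoint P (Finset.mem_sdiff.1 hP).1 Q (Finset.mem_sdiff.1 hQ).1) T
      (fun S => T ∈ N S) fun S _ h h' => (Finset.mem_filter.1 h).2 h'.symm).trans
      (hFk T (hF₀ (Finset.mem_sdiff.1 hT).1))
  have hAn : (A.card : ℝ) ≤ n := by
    exact_mod_cast Finset.card_le_card (Finset.sdiff_subset.trans hF₀)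
  have hmain : (B.card : ℝ) ≤ (((k : ℝ) + 1) / 3 + ε) * A.card := by
    refine SetPacking.card_le_of_not_hasNarrowImprovement hk hε hI hd.le hc.ge
      (hAn.trans_lt hTn) (fun S _ => Finset.filter_subset _ _) hNk hdeg ?_
    rintro ⟨X, hXB, hlt, hcard, m, Y, hYX, hYw, hcov, hY, hYN⟩
    have hX0 : ∀ S ∈ X, S ∉ F₀ := fun S hS => (Finset.mem_sdiff.1 (hXB hS)).2
    have hXF : X ⊆ F := hXB.trans hBF
    have hNX : ∀ S ∈ X, ∀ T, T ∈ N S ↔ T ∈ F₀ ∧ ¬ Disjoint S T := fun S hS => hNiff S (hXB hS)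
    refine hno ⟨{S | S.1 ∈ X}, SetPacking.isImprovingSet_setOf_mem hX0 hXF hF₀ hNX ?_ hlt, ?_,
      SetPacking.improvingPathwidth_le hX0 hXF hNX (fun S hS => hNk S (hXB hS)) Y hYX hYw hcov
        hY hYN⟩
    · exact fun P hP Q hQ => hOPT.disjoint P (Finset.mem_sdiff.1 (hXB hP)).1 Q
        (Finset.mem_sdiff.1 (hXB hQ)).1
    · rw [SetPacking.ncard_setOf_mem hXF]
      have h1 : (X.card : ℝ) ≤ c * (4 * (T + 1) + 2) := by exact_mod_cast hcard
      have h2 : (1 : ℝ) ≤ Real.log n / Real.log 2 := (one_le_div hlog2).2 hlogn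
      refine h1.trans ?_
      rw [mul_assoc]
      refine mul_le_mul_of_nonneg_left ?_ (Nat.cast_nonneg _)
      calc 4 * ((T : ℝ) + 1) + 2 ≤ 4 * (Real.log n / μ) + 10 * (Real.log n / Real.log 2) := by
            linarith
        _ = (4 / μ + 10 / Real.log 2) * Real.log n := by ring
  have h1 : (OPT.card : ℝ) = B.card + (OPT ∩ F₀).card := by
    exact_mod_cast (Finset.card_sdiff_add_card_inter OPT F₀).symm
  have h2 : (F₀.card : ℝ) = A.card + (OPT ∩ F₀).card := by
    rw [Finset.inter_comm]
    exact_mod_cast (Finset.card_sdiff_add_card_inter F₀ OPT).symm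
  have hk' : (2 : ℝ) ≤ k := by exact_mod_cast hk
  have h3 : (0 : ℝ) ≤ (OPT ∩ F₀).card := Nat.cast_nonneg _
  rw [h1, h2]
  -- The common part `OPT ∩ F₀` is absorbed because the factor is at least 1 for `k ≥ 2`.
  nlinarith [mul_nonneg (sub_nonneg.2 hk') h3, mul_nonneg hε.le h3]
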